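/- For $a\in\mathbb{C}$ let $J_a$ be the bounded operator on $\ell^2(\mathbb{N})$, $\mathbb{N}=\{1,2,3,\dots\}$, given by the tridiagonal matrix with diagonal $(a,0,0,\dots)$ and all entries of the two neighbouring diagonals equal to $1$; that is, $(J_a\psi)_1=a\psi_1+\psi_2$ and $(J_a\psi)_n=\psi_{n-1}+\psi_{n+1}$ for $n\ge 2$. For a bounded operator $T$ let $\sigma(T)$ be its spectrum and let $\sigma_c(T)$, the continuous spectrum, be the set of those $z\in\sigma(T)$ for which $T-z$ is injective with dense range. Let $a\in(-1,1)$, let $v=(v_n)_{n\ge1}$ be a complex sequence and let $V=\operatorname{diag}(v_1,v_2,\dots)$. If $$\sum_{m,n=1}^{\infty}|v_m|\left[\frac{|a|}{1-|a|}+\min(m,n)\right]^2|v_n|<1, \tag{1}$$ then $v$ is bounded, so that $V$ is a bounded operator on $\ell^2(\mathbb{N})$, and $$\sigma(J_a+V)=\sigma_c(J_a+V)=\sigma(J_a).$$ Moreover, the condition $$\sum_{n=1}^{\infty}\left(\frac{|a|}{1-|a|}+n^2\right)|v_n|<1 \tag{2}$$ implies (1), so that the same conclusion holds under (2). -/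

import Mathlib

noncomputable section

/-- The Hilbert space `ℓ²(ℕ)` of square summable complex sequences `(ψ₁, ψ₂, …)`.
The entry with index `n : ℕ` in Lean is the `(n + 1)`-st entry `ψ_{n+1}` of the sequence. -/
abbrev EllTwo : Type := lp (fun _ : ℕ => ℂ) 2

namespace EllTwo

theorem summable_sq (ψ : EllTwo) : Summable fun n => ‖ψ n‖ ^ 2 := by
  have h := (lp.memℓp ψ).summable (by norm_num)
  simpa using h

theorem memℓp_of_summable_sq {f : ℕ → ℂ} (h : Summable fun n => ‖f n‖ ^ 2) :
    Memℓp f 2 := by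
  refine memℓp_gen ?_
  simpa using h

theorem continuous_coord (n : ℕ) : Continuous fun ψ : EllTwo => ψ n :=
  (lp.lipschitzWith_one_eval 2 n).continuous

/-- A linear map `F` on sequences each of whose entries depends continuously on `ψ ∈ ℓ²(ℕ)`,
and which maps `ℓ²(ℕ)` into `ℓ²(ℕ)`, as a bounded operator on `ℓ²(ℕ)`
(bounded by the closed graph theorem). -/
def opOfFun (F : (ℕ → ℂ) →ₗ[ℂ] (ℕ → ℂ)) (hmem : ∀ ψ : EllTwo, Memℓp (F ψ) 2)
    (hcont : ∀ n, Continuous fun ψ : EllTwo => F ψ n) : EllTwo →L[ℂ] EllTwo :=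
  ContinuousLinearMap.ofSeqClosedGraph
    (g := ({ toFun := fun ψ => ⟨F ψ, hmem ψ⟩
             map_add' := fun ψ φ => by
               apply Subtype.ext
               exact F.map_add (ψ : ℕ → ℂ) (φ : ℕ → ℂ)
             map_smul' := fun c ψ => by
               apply Subtype.ext
               exact F.map_smul c (ψ : ℕ → ℂ) } : EllTwo →ₗ[ℂ] EllTwo))
    (by
      intro u x y hu hy
      apply lp.ext
      funext n
      have h1 := ((continuous_coord n).tendsto y).comp hy
      have h2 := ((hcont n).tendsto x).comp hu
      exact tendsto_nhds_unique h1 h2)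

theorem opOfFun_apply (F : (ℕ → ℂ) →ₗ[ℂ] (ℕ → ℂ)) (hmem : ∀ ψ : EllTwo, Memℓp (F ψ) 2)
    (hcont : ∀ n, Continuous fun ψ : EllTwo => F ψ n) (ψ : EllTwo) (n : ℕ) :
    opOfFun F hmem hcont ψ n = F ψ n := rfl

end EllTwo

/-- The action on sequences of the tridiagonal matrix with diagonal `(a, 0, 0, …)` and all
entries of the two neighbouring diagonals equal to `1`. -/
def jacobiFun (a : ℂ) : (ℕ → ℂ) →ₗ[ℂ] (ℕ → ℂ) where
  toFun ψ n := match n with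
    | 0 => a * ψ 0 + ψ 1
    | n + 1 => ψ n + ψ (n + 2)
  map_add' ψ φ := by
    funext n
    cases n <;> simp only [Pi.add_apply] <;> ring
  map_smul' c ψ := by
    funext n
    cases n <;> simp only [Pi.smul_apply, smul_eq_mul, RingHom.id_apply] <;> ring

/-- The discrete Robin Laplacian `J_a` on `ℓ²(ℕ)` with coupling constant `a ∈ ℂ`:
`(J_a ψ)₁ = a ψ₁ + ψ₂` and `(J_a ψ)_n = ψ_{n-1} + ψ_{n+1}` for `n ≥ 2`. -/
def robinJacobi (a : ℂ) : EllTwo →L[ℂ] EllTwo :=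
  EllTwo.opOfFun (jacobiFun a)
    (by
      intro ψ
      apply EllTwo.memℓp_of_summable_sq
      rw [← summable_nat_add_iff 1]
      have h := ψ.summable_sq
      have h2 := (summable_nat_add_iff 2).2 h
      refine Summable.of_nonneg_of_le (fun n => by positivity) (fun n => ?_)
        ((h.add h2).mul_left 2)
      have h3 : ‖ψ n + ψ (n + 2)‖ ≤ ‖ψ n‖ + ‖ψ (n + 2)‖ := norm_add_le _ _
      change ‖ψ n + ψ (n + 2)‖ ^ 2 ≤ 2 * (‖ψ n‖ ^ 2 + ‖ψ (n + 2)‖ ^ 2)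
      nlinarith [norm_nonneg (ψ n + ψ (n + 2)), sq_nonneg (‖ψ n‖ - ‖ψ (n + 2)‖)])
    (by
      intro n
      cases n with
      | zero =>
        exact (continuous_const.mul (EllTwo.continuous_coord 0)).add (EllTwo.continuous_coord 1)
      | succ n => exact (EllTwo.continuous_coord n).add (EllTwo.continuous_coord (n + 2)))

theorem robinJacobi_apply_zero (a : ℂ) (ψ : EllTwo) :
    robinJacobi a ψ 0 = a * ψ 0 + ψ 1 := rfl

theorem robinJacobi_apply_succ (a : ℂ) (ψ : EllTwo) (n : ℕ) :
    robinJacobi a ψ (n + 1) = ψ n + ψ (n + 2) := rfl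

/-- The action on sequences of the diagonal matrix `diag(v₁, v₂, …)`. -/
def diagFun (v : ℕ → ℂ) : (ℕ → ℂ) →ₗ[ℂ] (ℕ → ℂ) where
  toFun ψ n := v n * ψ n
  map_add' ψ φ := by
    funext n
    simp only [Pi.add_apply]
    ring
  map_smul' c ψ := by
    funext n
    simp only [Pi.smul_apply, smul_eq_mul, RingHom.id_apply]
    ring

/-- The potential `V = diag(v₁, v₂, …)` of a bounded complex sequence `v`, as a bounded operator
on `ℓ²(ℕ)`; here `v n` is the `(n + 1)`-st entry `v_{n+1}`. -/
def potential (v : ℕ → ℂ) (hv : BddAbove (Set.range fun n => ‖v n‖)) : EllTwo →L[ℂ] EllTwo :=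
  EllTwo.opOfFun (diagFun v)
    (by
      intro ψ
      apply EllTwo.memℓp_of_summable_sq
      obtain ⟨C, hC⟩ := hv
      refine Summable.of_nonneg_of_le (fun n => by positivity) (fun n => ?_)
        (ψ.summable_sq.mul_left (C ^ 2))
      have h1 : ‖v n‖ ≤ C := hC ⟨n, rfl⟩
      change ‖v n * ψ n‖ ^ 2 ≤ C ^ 2 * ‖ψ n‖ ^ 2
      rw [norm_mul, mul_pow]
      gcongr)
    (fun n => continuous_const.mul (EllTwo.continuous_coord n))

theorem potential_apply (v : ℕ → ℂ) (hv : BddAbove (Set.range fun n => ‖v n‖)) (ψ : EllTwo)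
    (n : ℕ) : potential v hv ψ n = v n * ψ n := rfl

/-- The continuous spectrum `σ_c(T)` of a bounded operator `T`: the points `z` of the spectrum for
which `T - z` is injective with dense range. The rest of the spectrum consists of the point
spectrum (`T - z` not injective) and of the residual spectrum (`T - z` injective, with range that
is not dense). -/
def continuousSpectrum (T : EllTwo →L[ℂ] EllTwo) : Set ℂ :=
  {z | z ∈ spectrum ℂ T ∧ Function.Injective (fun ψ : EllTwo => T ψ - z • ψ) ∧
    DenseRange (fun ψ : EllTwo => T ψ - z • ψ)}

/-- Spectral stability of `J_a` under the potential `V = diag(v₁, v₂, …)`: the sequence `v` is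
bounded, so that `J_a + V` is a bounded operator on `ℓ²(ℕ)`, and
`σ(J_a + V) = σ_c(J_a + V) = σ(J_a)`. -/
def SpectrallyStable (a : ℂ) (v : ℕ → ℂ) : Prop :=
  ∃ hv : BddAbove (Set.range fun n => ‖v n‖),
    spectrum ℂ (robinJacobi a + potential v hv) =
        continuousSpectrum (robinJacobi a + potential v hv) ∧
      continuousSpectrum (robinJacobi a + potential v hv) = spectrum ℂ (robinJacobi a)

/-- The condition `∑_{m,n ≥ 1} |v_m| (α + min(m, n))² |v_n| < 1` (the series of nonnegative terms
converges and its sum is less than `1`). -/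
def DoubleSumCondition (α : ℝ) (v : ℕ → ℂ) : Prop :=
  Summable (fun p : ℕ × ℕ =>
      ‖v p.1‖ * (α + (min (p.1 + 1) (p.2 + 1) : ℕ)) ^ 2 * ‖v p.2‖) ∧
    ∑' p : ℕ × ℕ, ‖v p.1‖ * (α + (min (p.1 + 1) (p.2 + 1) : ℕ)) ^ 2 * ‖v p.2‖ < 1

/-- The condition `∑_{n ≥ 1} (α + n²) |v_n| < 1` (the series of nonnegative terms converges and
its sum is less than `1`). -/
def WeightedCondition (α : ℝ) (v : ℕ → ℂ) : Prop :=
  Summable (fun n : ℕ => (α + ((n + 1 : ℕ) : ℝ) ^ 2) * ‖v n‖) ∧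
    ∑' n : ℕ, (α + ((n + 1 : ℕ) : ℝ) ^ 2) * ‖v n‖ < 1

end

/-!
Write `T = J_a + V`, `α = |a| / (1 - |a|)`, and `z = k + k⁻¹` with `0 < |k| ≤ 1`, which is possible
for every `z ∈ ℂ` (`exists_eq_add_inv`); the points with `|k| = 1` form the interval `[-2, 2]`.

*No eigenvalues.* If `T ψ = z ψ` then `χ_1 = (1 - k a) ψ_1`, `χ_{n+1} = ψ_{n+1} - k ψ_n` satisfies
`χ_n = k χ_{n+1} + k v_n ψ_n`. As `χ` tends to `0`, it is bounded by the tails of `∑ |v_n ψ_n|`,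
and solving for `ψ` gives `|ψ_m| ≤ ∑_n (α + min(m, n)) |v_n ψ_n|`, uniformly in `k` up to the
circle `|k| = 1` (`norm_le_tsum_of_eigenvector`). With `Q = ∑ |v_n| |ψ_n|²` and `D < 1` the double
sum, the Cauchy-Schwarz inequality yields `Q ≤ D Q`, so that `Q = 0` and then `ψ = 0`
(`DoubleSumCondition.eq_zero_of_le`). Hence `T - z` is injective for every `z ∈ ℂ`, and since the
matrix of `T` is symmetric, its range is dense
(`denseRange_robinJacobi_add_potential_sub`). All of the spectrum is thus continuous.

*The spectrum.* With the right shift `S` and the left shift `L` one has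
`(1 - k L) (1 - k S) = k (z - J_0)`. For `|k| < 1` both factors are invertible, for `|k| = 1` the
first one is not onto, because the harmonic series diverges; so `σ(J_0) = [-2, 2]`. The condition
forces `v` to be summable, hence `T - J_0` is compact. By the Fredholm alternative and the absence
of eigenvalues of both `J_0` and `T`, the operators `z - J_0` and `z - T` are invertible for the
same `z` (`spectrum_robinJacobi_add_potential`). The case `v = 0` gives the spectrum of `J_a`.

*The weighted condition.* It implies the other one because
`(α + min(m, n))² ≤ (α + m²) (α + n²)`.
-/

open Filter Topology

/-! ### Eigenvectors -/

/-- Every complex number is of the form `k + k⁻¹` with `0 < |k| ≤ 1`: the roots of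
`X ^ 2 - z X + 1` are inverse to each other. -/
theorem exists_eq_add_inv (z : ℂ) : ∃ k : ℂ, k ≠ 0 ∧ ‖k‖ ≤ 1 ∧ z = k + k⁻¹ := by
  obtain ⟨s, hs⟩ := IsAlgClosed.exists_eq_mul_self (z ^ 2 - 4)
  have hmul : (z + s) / 2 * ((z - s) / 2) = 1 := by linear_combination hs / 4
  have hk : (z + s) / 2 ≠ 0 := left_ne_zero_of_mul_eq_one hmul
  have hinv : ((z + s) / 2)⁻¹ = (z - s) / 2 := inv_eq_of_mul_eq_one_right hmul
  rcases le_total ‖(z + s) / 2‖ 1 with h | h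
  · exact ⟨_, hk, h, by rw [hinv]; ring⟩
  · refine ⟨((z + s) / 2)⁻¹, inv_ne_zero hk, ?_, by rw [inv_inv, hinv]; ring⟩
    rw [norm_inv]
    exact inv_le_one_of_one_le₀ h

theorem tsum_nat_add_eq {r : ℕ → ℝ} (hr : Summable r) (n : ℕ) :
    ∑' j, r (j + n) = r n + ∑' j, r (j + (n + 1)) := by
  rw [((summable_nat_add_iff n).2 hr).tsum_eq_zero_add, zero_add]
  simp only [add_assoc, add_comm 1 n]

/-- A null sequence is controlled by the tails of a bound on its increments. -/
theorem norm_le_tsum_nat_add {χ : ℕ → ℂ} {r : ℕ → ℝ} (hχ : Tendsto χ atTop (𝓝 0))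
    (hr : Summable r) (h : ∀ n, ‖χ n‖ ≤ ‖χ (n + 1)‖ + r n) (n : ℕ) :
    ‖χ n‖ ≤ ∑' j, r (j + n) := by
  have hmono : Monotone fun n => ‖χ n‖ - ∑' j, r (j + n) :=
    monotone_nat_of_le_succ fun n => by
      have := h n
      rw [tsum_nat_add_eq hr n]
      linarith
  have hlim : Tendsto (fun n => ‖χ n‖ - ∑' j, r (j + n)) atTop (𝓝 0) := by
    simpa using hχ.norm.sub (tendsto_sum_nat_add r)
  have := hmono.ge_of_tendsto hlim n
  linarith

theorem add_min_bounds {α : ℝ} (hα : 0 ≤ α) (m n : ℕ) :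
    1 ≤ α + (min (m + 1) (n + 1) : ℕ) ∧ α + (min (m + 1) (n + 1) : ℕ) ≤ α + (m + 1) := by
  have h1 : 1 ≤ min (m + 1) (n + 1) := by omega
  have h2 : min (m + 1) (n + 1) ≤ m + 1 := min_le_left _ _
  have h1' : (1 : ℝ) ≤ (min (m + 1) (n + 1) : ℕ) := by exact_mod_cast h1
  have h2' : ((min (m + 1) (n + 1) : ℕ) : ℝ) ≤ m + 1 := by exact_mod_cast h2
  constructor <;> linarith

theorem summable_add_min_pow_mul {α : ℝ} (hα : 0 ≤ α) {r : ℕ → ℝ} (hr : Summable r)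
    (hr0 : ∀ n, 0 ≤ r n) (m p : ℕ) :
    Summable fun n => (α + (min (m + 1) (n + 1) : ℕ)) ^ p * r n := by
  refine Summable.of_nonneg_of_le (fun n => ?_) (fun n => ?_) (hr.mul_left ((α + (m + 1)) ^ p))
  · have := (add_min_bounds hα m n).1
    have := hr0 n
    positivity
  · obtain ⟨h1, h2⟩ := add_min_bounds hα m n
    have := hr0 n
    gcongr

theorem tsum_add_min_mul_zero {α : ℝ} (r : ℕ → ℝ) :
    ∑' n, (α + (min (0 + 1) (n + 1) : ℕ)) * r n = (α + 1) * ∑' n, r n := by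
  rw [← tsum_mul_left]
  refine tsum_congr fun n => ?_
  have : min (0 + 1) (n + 1) = 1 := by omega
  rw [this, Nat.cast_one]

theorem tsum_add_min_mul_succ {α : ℝ} (hα : 0 ≤ α) {r : ℕ → ℝ} (hr : Summable r)
    (hr0 : ∀ n, 0 ≤ r n) (m : ℕ) :
    ∑' n, (α + (min (m + 1 + 1) (n + 1) : ℕ)) * r n =
      ∑' n, (α + (min (m + 1) (n + 1) : ℕ)) * r n + ∑' j, r (j + (m + 1)) := by
  have hs (m : ℕ) : Summable fun n => (α + (min (m + 1) (n + 1) : ℕ)) * r n := by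
    simpa using summable_add_min_pow_mul hα hr hr0 m 1
  rw [← (hs (m + 1)).sum_add_tsum_nat_add (m + 1), ← (hs m).sum_add_tsum_nat_add (m + 1),
    add_assoc (Finset.sum _ _), ← Summable.tsum_add ((summable_nat_add_iff (m + 1)).2 (hs m))
      ((summable_nat_add_iff (m + 1)).2 hr)]
  congr 1
  · refine Finset.sum_congr rfl fun n hn => ?_
    have hn := Finset.mem_range.1 hn
    have : min (m + 1 + 1) (n + 1) = min (m + 1) (n + 1) := by omega
    rw [this]
  · refine tsum_congr fun j => ?_
    have h1 : min (m + 1 + 1) (j + (m + 1) + 1) = m + 2 := by omega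
    have h2 : min (m + 1) (j + (m + 1) + 1) = m + 1 := by omega
    rw [h1, h2]
    push_cast
    ring

/-- The pointwise bound on eigenvectors of `J_a + V` that comes from the bound
`|G(m, n)| ≤ |a| / (1 - |a|) + min m n` on the Green kernel of `J_a`. The kernel itself is not
needed: the second order recurrence for `ψ` splits into two recurrences of first order, one for
`χ`, solved from infinity, and one for `ψ` in terms of `χ`, solved from the origin. -/
theorem norm_le_tsum_of_eigenvector {a : ℝ} (ha : |a| < 1) {v ψ : ℕ → ℂ} {k : ℂ} (hk0 : k ≠ 0)
    (hk1 : ‖k‖ ≤ 1) (hψ : Tendsto ψ atTop (𝓝 0)) (hv : Summable fun n => ‖v n * ψ n‖)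
    (h0 : a * ψ 0 + ψ 1 + v 0 * ψ 0 = (k + k⁻¹) * ψ 0)
    (hs : ∀ n, ψ n + ψ (n + 2) + v (n + 1) * ψ (n + 1) = (k + k⁻¹) * ψ (n + 1)) (m : ℕ) :
    ‖ψ m‖ ≤ ∑' n, (|a| / (1 - |a|) + (min (m + 1) (n + 1) : ℕ)) * ‖v n * ψ n‖ := by
  have hα : 0 ≤ |a| / (1 - |a|) := div_nonneg (abs_nonneg a) (by linarith)
  have hkk : k * k⁻¹ = 1 := mul_inv_cancel₀ hk0
  let χ : ℕ → ℂ := fun n => match n with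
    | 0 => (1 - k * a) * ψ 0
    | n + 1 => ψ (n + 1) - k * ψ n
  have hχ : Tendsto χ atTop (𝓝 0) := by
    rw [← tendsto_add_atTop_iff_nat 1]
    simpa using (hψ.comp (tendsto_add_atTop_nat 1)).sub (hψ.const_mul k)
  -- Multiplied by `k`, the eigenvalue equation becomes a recurrence of first order for `χ`.
  have hrec (n : ℕ) : χ n = k * χ (n + 1) + k * (v n * ψ n) := by
    cases n with
    | zero =>
      change (1 - k * a) * ψ 0 = k * (ψ 1 - k * ψ 0) + k * (v 0 * ψ 0)
      linear_combination (-k) * h0 - ψ 0 * hkk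
    | succ n =>
      change ψ (n + 1) - k * ψ n =
        k * (ψ (n + 2) - k * ψ (n + 1)) + k * (v (n + 1) * ψ (n + 1))
      linear_combination (-k) * hs n - ψ (n + 1) * hkk
  have hχle := norm_le_tsum_nat_add hχ hv fun n => by
    rw [hrec n]
    refine (norm_add_le _ _).trans ?_
    rw [norm_mul k, norm_mul k]
    gcongr <;> exact mul_le_of_le_one_left (norm_nonneg _) hk1
  induction m with
  | zero =>
    rw [tsum_add_min_mul_zero]
    have h1 : 1 - |a| ≤ ‖1 - k * a‖ := by
      have h2 := norm_sub_norm_le (1 : ℂ) (k * a)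
      have h3 : ‖k * (a : ℂ)‖ ≤ |a| := by
        rw [norm_mul, Complex.norm_real, Real.norm_eq_abs]
        exact mul_le_of_le_one_left (abs_nonneg a) hk1
      rw [norm_one] at h2
      linarith
    have h2 : (1 - |a|) * ‖ψ 0‖ ≤ ∑' n, ‖v n * ψ n‖ := by
      calc (1 - |a|) * ‖ψ 0‖ ≤ ‖1 - k * a‖ * ‖ψ 0‖ := by gcongr
        _ = ‖χ 0‖ := (norm_mul _ _).symm
        _ ≤ _ := by simpa using hχle 0
    have h3 : |a| / (1 - |a|) + 1 = (1 - |a|)⁻¹ := by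
      have : 1 - |a| ≠ 0 := by linarith
      field_simp
      ring
    rw [h3]
    exact (le_inv_mul_iff₀ (by linarith)).2 h2
  | succ m ih =>
    rw [tsum_add_min_mul_succ hα hv (fun n => norm_nonneg _)]
    have h1 : ψ (m + 1) = k * ψ m + χ (m + 1) := by
      change ψ (m + 1) = k * ψ m + (ψ (m + 1) - k * ψ m)
      ring
    calc ‖ψ (m + 1)‖ ≤ ‖k‖ * ‖ψ m‖ + ‖χ (m + 1)‖ := by
          rw [h1, ← norm_mul]
          exact norm_add_le _ _
      _ ≤ ‖ψ m‖ + ‖χ (m + 1)‖ := by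
          gcongr
          exact mul_le_of_le_one_left (norm_nonneg _) hk1
      _ ≤ _ := add_le_add ih (hχle (m + 1))

theorem DoubleSumCondition.summable_norm {α : ℝ} (hα : 0 ≤ α) {v : ℕ → ℂ}
    (h : DoubleSumCondition α v) : Summable fun n => ‖v n‖ := by
  by_cases hv : ∀ n, v n = 0
  · simp [hv, summable_zero]
  push Not at hv
  -- One column of the double series, with `v n ≠ 0`, already dominates `∑ |v_m|`.
  obtain ⟨n, hn⟩ := hv
  have hn := norm_pos_iff.2 hn
  have h1 := h.1.comp_injective (i := fun m : ℕ => (m, n)) fun m m' hm => (Prod.ext_iff.1 hm).1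
  refine Summable.of_nonneg_of_le (fun m => norm_nonneg _) (fun m => ?_) (h1.mul_right ‖v n‖⁻¹)
  have h2 := one_le_pow₀ (n := 2) (add_min_bounds hα m n).1
  rw [Function.comp_apply, mul_inv_cancel_right₀ hn.ne']
  exact le_mul_of_one_le_right (norm_nonneg _) h2

/-- The Cauchy-Schwarz inequality with respect to the weight `r`. -/
theorem tsum_mul_sq_le {c r x : ℕ → ℝ} (hr : ∀ n, 0 ≤ r n) (hc : ∀ n, 0 ≤ c n)
    (hx : ∀ n, 0 ≤ x n)
    (hcr : Summable fun n => c n ^ 2 * r n) (hrx : Summable fun n => r n * x n ^ 2) :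
    (∑' n, c n * (r n * x n)) ^ 2 ≤ (∑' n, c n ^ 2 * r n) * ∑' n, r n * x n ^ 2 := by
  have hA : 0 ≤ ∑' n, c n ^ 2 * r n := tsum_nonneg fun n => mul_nonneg (sq_nonneg _) (hr n)
  have hB : 0 ≤ ∑' n, r n * x n ^ 2 := tsum_nonneg fun n => mul_nonneg (hr n) (sq_nonneg _)
  have hle (s : Finset ℕ) : ∑ n ∈ s, c n * (r n * x n) ≤
      √((∑' n, c n ^ 2 * r n) * ∑' n, r n * x n ^ 2) := by
    refine Real.le_sqrt_of_sq_le ?_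
    calc _ ≤ (∑ n ∈ s, c n ^ 2 * r n) * ∑ n ∈ s, r n * x n ^ 2 :=
          Finset.sum_sq_le_sum_mul_sum_of_sq_le_mul s
            (fun n _ => mul_nonneg (sq_nonneg _) (hr n))
            (fun n _ => mul_nonneg (hr n) (sq_nonneg _)) fun n _ => le_of_eq (by ring)
      _ ≤ _ := mul_le_mul
          (hcr.sum_le_tsum s fun n _ => mul_nonneg (sq_nonneg _) (hr n))
          (hrx.sum_le_tsum s fun n _ => mul_nonneg (hr n) (sq_nonneg _))
          (Finset.sum_nonneg fun n _ => mul_nonneg (hr n) (sq_nonneg _)) hA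
  have h0 (n : ℕ) : 0 ≤ c n * (r n * x n) := mul_nonneg (hc n) (mul_nonneg (hr n) (hx n))
  have := Real.tsum_le_of_sum_le h0 hle
  calc _ ≤ √((∑' n, c n ^ 2 * r n) * ∑' n, r n * x n ^ 2) ^ 2 :=
        pow_le_pow_left₀ (tsum_nonneg h0) this 2
    _ = _ := Real.sq_sqrt (mul_nonneg hA hB)

/-- The Birman-Schwinger argument: weighting the pointwise bound by `|v_m|`, the double sum
dominates the squared Hilbert-Schmidt norm of an operator that fixes `|v|^{1/2} ψ`. -/
theorem DoubleSumCondition.eq_zero_of_le {α : ℝ} (hα : 0 ≤ α) {v : ℕ → ℂ}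
    (h : DoubleSumCondition α v) {ψ : ℕ → ℂ} (hψ : Summable fun n => ‖v n‖ * ‖ψ n‖ ^ 2)
    (hle : ∀ m, ‖ψ m‖ ≤ ∑' n, (α + (min (m + 1) (n + 1) : ℕ)) * ‖v n * ψ n‖) (m : ℕ) :
    ψ m = 0 := by
  have hv := h.summable_norm hα
  have hc (m n : ℕ) : 0 ≤ α + (min (m + 1) (n + 1) : ℕ) :=
    zero_le_one.trans (add_min_bounds hα m n).1
  have hnn (n : ℕ) : 0 ≤ ‖v n‖ * ‖ψ n‖ ^ 2 := by positivity
  have hsq (m : ℕ) : ‖ψ m‖ ^ 2 ≤ (∑' n, (α + (min (m + 1) (n + 1) : ℕ)) ^ 2 * ‖v n‖) *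
      ∑' n, ‖v n‖ * ‖ψ n‖ ^ 2 := by
    refine (pow_le_pow_left₀ (norm_nonneg _) (hle m) 2).trans ?_
    simp only [norm_mul]
    exact tsum_mul_sq_le (fun n => norm_nonneg _) (hc m) (fun n => norm_nonneg _)
      (summable_add_min_pow_mul hα hv (fun n => norm_nonneg _) m 2) hψ
  have hprod : ∑' p : ℕ × ℕ,
        ‖v p.1‖ * (α + (min (p.1 + 1) (p.2 + 1) : ℕ)) ^ 2 * ‖v p.2‖ =
      ∑' m, ‖v m‖ * ∑' n, (α + (min (m + 1) (n + 1) : ℕ)) ^ 2 * ‖v n‖ := by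
    rw [h.1.tsum_prod]
    refine tsum_congr fun m => ?_
    rw [← tsum_mul_left]
    exact tsum_congr fun n => mul_assoc _ _ _
  have hsum : Summable fun m => ‖v m‖ * ∑' n, (α + (min (m + 1) (n + 1) : ℕ)) ^ 2 * ‖v n‖ := by
    refine h.1.prod.congr fun m => ?_
    rw [← tsum_mul_left]
    exact tsum_congr fun n => mul_assoc _ _ _
  have hS : ∑' n, ‖v n‖ * ‖ψ n‖ ^ 2 ≤
      (∑' p : ℕ × ℕ, ‖v p.1‖ * (α + (min (p.1 + 1) (p.2 + 1) : ℕ)) ^ 2 * ‖v p.2‖) *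
        ∑' n, ‖v n‖ * ‖ψ n‖ ^ 2 := by
    rw [hprod, ← tsum_mul_right]
    refine hψ.tsum_le_tsum (fun m => ?_) (hsum.mul_right _)
    rw [mul_assoc]
    exact mul_le_mul_of_nonneg_left (hsq m) (norm_nonneg _)
  have hS0 : ∑' n, ‖v n‖ * ‖ψ n‖ ^ 2 = 0 := by
    refine le_antisymm ?_ (tsum_nonneg hnn)
    by_contra! hpos
    have := mul_lt_mul_of_pos_right h.2 hpos
    linarith
  have := hsq m
  rw [hS0, mul_zero] at this
  simpa using this

namespace EllTwo

theorem tendsto_zero (ψ : EllTwo) : Tendsto (fun n => ψ n) atTop (𝓝 0) := by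
  have h := (ψ.summable_sq.tendsto_atTop_zero).sqrt
  simp only [Real.sqrt_sq (norm_nonneg _), Real.sqrt_zero] at h
  exact tendsto_zero_iff_norm_tendsto_zero.2 h

theorem norm_sq_eq_tsum (ψ : EllTwo) : ‖ψ‖ ^ 2 = ∑' n, ‖ψ n‖ ^ 2 := by
  have h := lp.norm_rpow_eq_tsum (p := 2) (by norm_num) ψ
  simpa using h

end EllTwo

theorem eq_zero_of_robinJacobi_add_potential_eq {a : ℝ} (ha : |a| < 1) {v : ℕ → ℂ}
    (hv : BddAbove (Set.range fun n => ‖v n‖)) (h : DoubleSumCondition (|a| / (1 - |a|)) v)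
    {z : ℂ} {ψ : EllTwo} (hψ : (robinJacobi a + potential v hv) ψ = z • ψ) : ψ = 0 := by
  have hα : 0 ≤ |a| / (1 - |a|) := div_nonneg (abs_nonneg a) (by linarith)
  obtain ⟨k, hk0, hk1, rfl⟩ := exists_eq_add_inv z
  have hcoord (n : ℕ) : robinJacobi a ψ n + v n * ψ n = (k + k⁻¹) * ψ n :=
    congrFun (congrArg (fun φ : EllTwo => (φ : ℕ → ℂ)) hψ) n
  have hvs := h.summable_norm hα
  have hbd (n : ℕ) : ‖ψ n‖ ≤ ‖ψ‖ := lp.norm_apply_le_norm two_ne_zero ψ n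
  have hw : Summable fun n => ‖v n * ψ n‖ := by
    refine Summable.of_nonneg_of_le (fun n => norm_nonneg _) (fun n => ?_) (hvs.mul_right ‖ψ‖)
    rw [norm_mul]
    exact mul_le_mul_of_nonneg_left (hbd n) (norm_nonneg _)
  have hw2 : Summable fun n => ‖v n‖ * ‖ψ n‖ ^ 2 := by
    refine Summable.of_nonneg_of_le (fun n => by positivity) (fun n => ?_)
      (hvs.mul_right (‖ψ‖ ^ 2))
    have := hbd n
    gcongr
  apply lp.ext
  funext n
  exact h.eq_zero_of_le hα hw2 (norm_le_tsum_of_eigenvector ha hk0 hk1 ψ.tendsto_zero hw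
    (hcoord 0) fun n => hcoord (n + 1)) n

/-! ### The weighted condition -/

theorem WeightedCondition.doubleSumCondition {α : ℝ} (hα : 0 ≤ α) {v : ℕ → ℂ}
    (h : WeightedCondition α v) : DoubleSumCondition α v := by
  have h0 (n : ℕ) : 0 ≤ (α + ((n + 1 : ℕ) : ℝ) ^ 2) * ‖v n‖ := by positivity
  have hmul := h.1.mul_of_nonneg h.1 h0 h0
  have hle (p : ℕ × ℕ) : ‖v p.1‖ * (α + (min (p.1 + 1) (p.2 + 1) : ℕ)) ^ 2 * ‖v p.2‖ ≤
      (α + ((p.1 + 1 : ℕ) : ℝ) ^ 2) * ‖v p.1‖ * ((α + ((p.2 + 1 : ℕ) : ℝ) ^ 2) * ‖v p.2‖) := by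
    have hi (n : ℕ) (hn : min (p.1 + 1) (p.2 + 1) ≤ n) :
        α + (min (p.1 + 1) (p.2 + 1) : ℕ) ≤ α + (n : ℝ) ^ 2 := by
      have : min (p.1 + 1) (p.2 + 1) ≤ n ^ 2 := hn.trans (Nat.le_self_pow two_ne_zero n)
      have : ((min (p.1 + 1) (p.2 + 1) : ℕ) : ℝ) ≤ (n : ℝ) ^ 2 := by exact_mod_cast this
      linarith
    have h1 := mul_le_mul (hi _ (min_le_left _ _)) (hi _ (min_le_right _ _))
      (by positivity) (by positivity)
    calc _ = (α + (min (p.1 + 1) (p.2 + 1) : ℕ)) * (α + (min (p.1 + 1) (p.2 + 1) : ℕ)) *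
          (‖v p.1‖ * ‖v p.2‖) := by ring
      _ ≤ _ := mul_le_mul_of_nonneg_right h1 (by positivity)
      _ = _ := by ring
  have hsum := Summable.of_nonneg_of_le (fun p : ℕ × ℕ => by positivity) hle hmul
  refine ⟨hsum, (hsum.tsum_le_tsum hle hmul).trans_lt ?_⟩
  rw [← h.1.tsum_mul_tsum h.1 hmul]
  exact mul_lt_one_of_nonneg_of_lt_one_left (tsum_nonneg h0) h.2 h.2.le

/-! ### Symmetry and density of the range -/

/-- The matrix of `J_a + V` is symmetric, so that a vector orthogonal to the range of
`J_a + V - z` is the complex conjugate of a vector in the kernel. There is thus no residual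
spectrum as soon as there are no eigenvalues. -/
theorem denseRange_robinJacobi_add_potential_sub {a : ℂ} {v : ℕ → ℂ}
    (hv : BddAbove (Set.range fun n => ‖v n‖)) {z : ℂ}
    (h : ∀ ψ : EllTwo, (robinJacobi a + potential v hv) ψ = z • ψ → ψ = 0) :
    DenseRange fun ψ : EllTwo => (robinJacobi a + potential v hv) ψ - z • ψ := by
  set T := robinJacobi a + potential v hv with hT
  have hdense : Dense
      (LinearMap.range (T - z • (1 : EllTwo →L[ℂ] EllTwo)).toLinearMap : Set EllTwo) := by
    rw [Submodule.dense_iff_topologicalClosure_eq_top, Submodule.topologicalClosure_eq_top_iff,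
      Submodule.eq_bot_iff]
    intro φ hφ
    have horth (ψ : EllTwo) : inner ℂ (T ψ - z • ψ) φ = 0 :=
      (Submodule.mem_orthogonal _ _).1 hφ _ ⟨ψ, rfl⟩
    let e : ℕ → EllTwo := fun n => lp.single 2 n (1 : ℂ)
    have he (n : ℕ) : inner ℂ (e n) φ = φ n := by
      simp [e, lp.inner_single_left]
    have he0 : T (e 0) - z • e 0 = (a + v 0 - z) • e 0 + e 1 := by
      apply lp.ext
      funext n
      change robinJacobi a (e 0) n + v n * e 0 n - z * e 0 n = (a + v 0 - z) * e 0 n + e 1 n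
      rcases n with _ | _ | n
      · rw [robinJacobi_apply_zero]
        simp [e, lp.single_apply]
      · rw [robinJacobi_apply_succ]
        simp [e, lp.single_apply]
      · rw [robinJacobi_apply_succ]
        simp [e, lp.single_apply]
    have hes (m : ℕ) : T (e (m + 1)) - z • e (m + 1) =
        e m + e (m + 2) + (v (m + 1) - z) • e (m + 1) := by
      apply lp.ext
      funext n
      change robinJacobi a (e (m + 1)) n + v n * e (m + 1) n - z * e (m + 1) n =
        e m n + e (m + 2) n + (v (m + 1) - z) * e (m + 1) n
      have hdiag : v n * e (m + 1) n = v (m + 1) * e (m + 1) n := by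
        by_cases hn : n = m + 1
        · rw [hn]
        · simp [e, lp.single_apply, hn]
      rw [hdiag]
      cases n with
      | zero =>
        rw [robinJacobi_apply_zero]
        simp [e, lp.single_apply, Pi.single_apply, eq_comm]
      | succ n =>
        rw [robinJacobi_apply_succ]
        have h1 : e (m + 1) n = e (m + 2) (n + 1) := by
          simp [e, lp.single_apply, Pi.single_apply]
        have h2 : e (m + 1) (n + 2) = e m (n + 1) := by
          simp [e, lp.single_apply, Pi.single_apply]
        rw [h1, h2]
        ring
    rw [← star_eq_zero]
    apply h
    apply lp.ext
    funext n
    change robinJacobi a (star φ) n + v n * star φ n = z * star φ n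
    cases n with
    | zero =>
      have h0 := congrArg star (horth (e 0))
      rw [he0, inner_add_left, inner_smul_left, he, he] at h0
      rw [robinJacobi_apply_zero]
      simp at h0 ⊢
      linear_combination h0
    | succ n =>
      have h0 := congrArg star (horth (e (n + 1)))
      rw [hes, inner_add_left, inner_add_left, inner_smul_left, he, he, he] at h0
      rw [robinJacobi_apply_succ]
      simp at h0 ⊢
      linear_combination h0
  exact hdense

/-! ### The free operator -/

/-- The right shift `(ψ₁, ψ₂, …) ↦ (0, ψ₁, ψ₂, …)` on `ℓ²(ℕ)`. -/
noncomputable def rightShift : EllTwo →L[ℂ] EllTwo :=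
  EllTwo.opOfFun
    { toFun := fun ψ n => match n with
        | 0 => 0
        | n + 1 => ψ n
      map_add' := fun ψ φ => by
        funext n
        cases n <;> simp
      map_smul' := fun c ψ => by
        funext n
        cases n <;> simp }
    (fun ψ => EllTwo.memℓp_of_summable_sq ((summable_nat_add_iff 1).1 ψ.summable_sq))
    (fun n => by
      cases n with
      | zero => exact continuous_const
      | succ n => exact EllTwo.continuous_coord n)

/-- The left shift `(ψ₁, ψ₂, …) ↦ (ψ₂, ψ₃, …)` on `ℓ²(ℕ)`. -/
noncomputable def leftShift : EllTwo →L[ℂ] EllTwo :=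
  EllTwo.opOfFun
    { toFun := fun ψ n => ψ (n + 1)
      map_add' := fun _ _ => rfl
      map_smul' := fun _ _ => rfl }
    (fun ψ => EllTwo.memℓp_of_summable_sq ((summable_nat_add_iff 1).2 ψ.summable_sq))
    (fun n => EllTwo.continuous_coord (n + 1))

theorem rightShift_apply_zero (ψ : EllTwo) : rightShift ψ 0 = 0 := rfl

theorem rightShift_apply_succ (ψ : EllTwo) (n : ℕ) : rightShift ψ (n + 1) = ψ n := rfl

theorem leftShift_apply (ψ : EllTwo) (n : ℕ) : leftShift ψ n = ψ (n + 1) := rfl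

theorem norm_rightShift_le : ‖rightShift‖ ≤ 1 := by
  refine ContinuousLinearMap.opNorm_le_bound _ zero_le_one fun ψ => ?_
  rw [one_mul]
  refine le_of_eq ((sq_eq_sq₀ (norm_nonneg _) (norm_nonneg _)).1 ?_)
  rw [EllTwo.norm_sq_eq_tsum, EllTwo.norm_sq_eq_tsum,
    (rightShift ψ).summable_sq.tsum_eq_zero_add]
  simp [rightShift_apply_zero, rightShift_apply_succ]

theorem norm_leftShift_le : ‖leftShift‖ ≤ 1 := by
  refine ContinuousLinearMap.opNorm_le_bound _ zero_le_one fun ψ => ?_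
  rw [one_mul]
  refine (sq_le_sq₀ (norm_nonneg _) (norm_nonneg _)).1 ?_
  rw [EllTwo.norm_sq_eq_tsum, EllTwo.norm_sq_eq_tsum, ψ.summable_sq.tsum_eq_zero_add]
  exact le_add_of_nonneg_left (sq_nonneg _)

/-- The factorization of the free operator into triangular factors, which holds since the left
shift is a left inverse of the right shift. -/
theorem one_sub_leftShift_mul_one_sub_rightShift {k : ℂ} (hk : k ≠ 0) :
    (1 - k • leftShift) * (1 - k • rightShift) =
      k • (algebraMap ℂ (EllTwo →L[ℂ] EllTwo) (k + k⁻¹) - robinJacobi 0) := by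
  apply ContinuousLinearMap.ext
  intro ψ
  apply lp.ext
  funext n
  have hkk : k * k⁻¹ = 1 := mul_inv_cancel₀ hk
  change ψ n - k * rightShift ψ n - k * (ψ (n + 1) - k * ψ n) =
    k * ((k + k⁻¹) * ψ n - robinJacobi 0 ψ n)
  cases n with
  | zero =>
    rw [rightShift_apply_zero, robinJacobi_apply_zero]
    linear_combination -ψ 0 * hkk
  | succ n =>
    rw [rightShift_apply_succ, robinJacobi_apply_succ]
    linear_combination -ψ (n + 1) * hkk

theorem isUnit_algebraMap_sub_robinJacobi_zero {k : ℂ} (hk0 : k ≠ 0) (hk1 : ‖k‖ < 1) :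
    IsUnit (algebraMap ℂ (EllTwo →L[ℂ] EllTwo) (k + k⁻¹) - robinJacobi 0) := by
  have hsmul {A : EllTwo →L[ℂ] EllTwo} (hA : ‖A‖ ≤ 1) : IsUnit (1 - k • A) := by
    refine isUnit_one_sub_of_norm_lt_one ?_
    rw [norm_smul]
    exact (mul_le_of_le_one_right (norm_nonneg _) hA).trans_lt hk1
  have h := (hsmul norm_leftShift_le).mul (hsmul norm_rightShift_le)
  rw [one_sub_leftShift_mul_one_sub_rightShift hk0] at h
  exact (isUnit_smul_iff (Units.mk0 k hk0) _).1 h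

theorem EllTwo.memℓp_one_div_mul_pow {k : ℂ} (hk : ‖k‖ = 1) :
    Memℓp (fun n : ℕ => (k ^ n)⁻¹ * ((1 / ((n : ℝ) + 1) : ℝ) : ℂ)) 2 := by
  apply EllTwo.memℓp_of_summable_sq
  have h := (summable_nat_add_iff 1).2 (Real.summable_one_div_nat_pow.2 one_lt_two)
  refine h.congr fun n => ?_
  rw [norm_mul, norm_inv, norm_pow, hk, one_pow, inv_one, one_mul, Complex.norm_real,
    Real.norm_eq_abs, sq_abs]
  push_cast
  rw [div_pow, one_pow]

/-- For `|k| = 1` the factor `1 - k • leftShift` is not onto: solving for the square summable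
sequence `k⁻ⁿ / (n + 1)` leads to the partial sums of the harmonic series. -/
theorem not_isUnit_algebraMap_sub_robinJacobi_zero {k : ℂ} (hk : ‖k‖ = 1) :
    ¬ IsUnit (algebraMap ℂ (EllTwo →L[ℂ] EllTwo) (k + k⁻¹) - robinJacobi 0) := by
  have hk0 : k ≠ 0 := norm_ne_zero_iff.1 (by rw [hk]; exact one_ne_zero)
  intro h
  obtain ⟨φ, hφ⟩ := (ContinuousLinearMap.isUnit_iff_bijective.1 h).2
    (k⁻¹ • ⟨_, EllTwo.memℓp_one_div_mul_pow hk⟩)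
  set χ : EllTwo := (1 - k • rightShift) φ
  have hχ : (1 - k • leftShift) χ = ⟨_, EllTwo.memℓp_one_div_mul_pow hk⟩ := by
    change ((1 - k • leftShift) * (1 - k • rightShift)) φ = _
    rw [one_sub_leftShift_mul_one_sub_rightShift hk0, smul_apply, hφ,
      smul_inv_smul₀ hk0]
  have hrec (n : ℕ) : χ n - k * χ (n + 1) = (k ^ n)⁻¹ * ((1 / ((n : ℝ) + 1) : ℝ) : ℂ) :=
    congrFun (congrArg (fun φ : EllTwo => (φ : ℕ → ℂ)) hχ) n
  have hsum (n : ℕ) :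
      ((∑ i ∈ Finset.range n, 1 / ((i : ℝ) + 1) : ℝ) : ℂ) = χ 0 - k ^ n * χ n := by
    induction n with
    | zero => simp
    | succ n ih =>
      have h1 := hrec n
      rw [eq_inv_mul_iff_mul_eq₀ (pow_ne_zero n hk0)] at h1
      rw [Finset.sum_range_succ, Complex.ofReal_add, ih, ← h1]
      ring
  have hbd (n : ℕ) : ∑ i ∈ Finset.range n, 1 / ((i : ℝ) + 1) ≤ ‖χ‖ + ‖χ‖ := by
    have h1 := congrArg norm (hsum n)
    rw [Complex.norm_real, Real.norm_eq_abs] at h1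
    calc _ ≤ _ := le_abs_self _
      _ = ‖χ 0 - k ^ n * χ n‖ := h1
      _ ≤ ‖χ 0‖ + ‖k ^ n * χ n‖ := norm_sub_le _ _
      _ ≤ _ := by
        rw [norm_mul, norm_pow, hk, one_pow, one_mul]
        exact add_le_add (lp.norm_apply_le_norm two_ne_zero χ 0)
          (lp.norm_apply_le_norm two_ne_zero χ n)
  obtain ⟨n, hn⟩ :=
    (Real.tendsto_sum_range_one_div_nat_succ_atTop.eventually_gt_atTop (‖χ‖ + ‖χ‖)).exists
  exact (hbd n).not_gt hn

/-! ### Compact perturbations -/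

theorem isCompactOperator_potential {v : ℕ → ℂ} (hv : BddAbove (Set.range fun n => ‖v n‖))
    (hs : Summable fun n => ‖v n‖) : IsCompactOperator (potential v hv) := by
  -- The matrix units, through which `V` is an absolutely convergent series of rank one operators.
  let P : ℕ → EllTwo →L[ℂ] EllTwo := fun n =>
    (lp.singleContinuousLinearMap ℂ (fun _ : ℕ => ℂ) 2 n).comp
      (lp.evalCLM ℂ (fun _ : ℕ => ℂ) 2 n)
  have hP (n : ℕ) (ψ : EllTwo) : P n ψ = lp.single 2 n (ψ n) := rfl
  have hPc (n : ℕ) : IsCompactOperator (P n) :=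
    (isCompactOperator_of_locallyCompactSpace_dom
      (lp.evalCLM ℂ (fun _ : ℕ => ℂ) 2 n)).clm_comp
        (lp.singleContinuousLinearMap ℂ (fun _ : ℕ => ℂ) 2 n)
  have hPn (n : ℕ) : ‖P n‖ ≤ 1 := by
    refine ContinuousLinearMap.opNorm_le_bound _ zero_le_one fun ψ => ?_
    rw [hP, lp.norm_single two_pos, one_mul]
    exact lp.norm_apply_le_norm two_ne_zero ψ n
  have hsum : Summable fun n => v n • P n := by
    refine Summable.of_norm_bounded hs fun n => ?_
    rw [norm_smul]
    exact mul_le_of_le_one_right (norm_nonneg _) (hPn n)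
  have heq : potential v hv = ∑' n, v n • P n := by
    apply ContinuousLinearMap.ext
    intro ψ
    apply lp.ext
    funext m
    have h1 := ((hsum.hasSum.mapL (ContinuousLinearMap.apply ℂ EllTwo ψ))).mapL
      (lp.evalCLM ℂ (fun _ : ℕ => ℂ) 2 m)
    have h2 : HasSum (fun n => v n * (lp.single 2 n (ψ n) : EllTwo) m) (v m * ψ m) := by
      convert hasSum_single m fun n hn => ?_ using 1
      · simp
      · simp [lp.single_apply, hn.symm]
    exact h2.unique h1
  rw [heq]
  refine isClosed_setOfPred_isCompactOperator.mem_of_tendsto hsum.hasSum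
    (Eventually.of_forall fun s => ?_)
  exact (compactOperator (RingHom.id ℂ) EllTwo EllTwo).sum_mem fun n _ =>
    Submodule.smul_mem _ _ (hPc n)

/-- A form of the Fredholm alternative: an injective compact perturbation of an invertible
operator is invertible. -/
theorem isUnit_sub_of_isCompactOperator {U K : EllTwo →L[ℂ] EllTwo} (hU : IsUnit U)
    (hK : IsCompactOperator K) (hinj : ∀ ψ, (U - K) ψ = 0 → ψ = 0) : IsUnit (U - K) := by
  obtain ⟨u, rfl⟩ := hU
  have hcomp : IsCompactOperator ((↑u⁻¹ : EllTwo →L[ℂ] EllTwo) * K) :=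
    hK.clm_comp (↑u⁻¹ : EllTwo →L[ℂ] EllTwo)
  have hfac : (u : EllTwo →L[ℂ] EllTwo) - K = u * (1 - ↑u⁻¹ * K) := by
    rw [mul_sub, mul_one, Units.mul_inv_cancel_left]
  rcases hcomp.hasEigenvalue_or_mem_resolventSet one_ne_zero with h | h
  · obtain ⟨ψ, hψ⟩ := h.exists_hasEigenvector
    refine absurd (hinj ψ ?_) hψ.2
    have h1 : ((↑u⁻¹ : EllTwo →L[ℂ] EllTwo) * K) ψ = ψ := by simpa using hψ.apply_eq_smul
    rw [hfac]
    change (u : EllTwo →L[ℂ] EllTwo) (ψ - ((↑u⁻¹ : EllTwo →L[ℂ] EllTwo) * K) ψ) = 0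
    rw [h1, sub_self, map_zero]
  · rw [hfac]
    refine u.isUnit.mul ?_
    have h1 : IsUnit (algebraMap ℂ (EllTwo →L[ℂ] EllTwo) 1 - ↑u⁻¹ * K) := h
    rwa [map_one] at h1

theorem potential_zero (hv : BddAbove (Set.range fun n => ‖(0 : ℕ → ℂ) n‖)) :
    potential 0 hv = 0 := by
  apply ContinuousLinearMap.ext
  intro ψ
  apply lp.ext
  funext n
  exact zero_mul (ψ n)

theorem doubleSumCondition_zero (α : ℝ) : DoubleSumCondition α 0 := by
  simp [DoubleSumCondition, summable_zero]

/-- The boundary term `a ψ₁` of `J_a` is a potential supported at the first site. -/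
theorem exists_robinJacobi_add_potential_eq (a : ℂ) {v : ℕ → ℂ}
    (hv : BddAbove (Set.range fun n => ‖v n‖)) (hs : Summable fun n => ‖v n‖) :
    ∃ K : EllTwo →L[ℂ] EllTwo, IsCompactOperator K ∧
      robinJacobi a + potential v hv = robinJacobi 0 + K := by
  have hb : Summable fun n => ‖(Pi.single 0 a : ℕ → ℂ) n‖ :=
    summable_of_ne_finset_zero (s := {0}) fun n hn => by
      simp [Finset.notMem_singleton.1 hn]
  have hb' : BddAbove (Set.range fun n => ‖(Pi.single 0 a : ℕ → ℂ) n‖) :=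
    hb.tendsto_atTop_zero.bddAbove_range
  refine ⟨potential _ hb' + potential v hv,
    (isCompactOperator_potential hb' hb).add (isCompactOperator_potential hv hs), ?_⟩
  rw [← add_assoc]
  congr 1
  apply ContinuousLinearMap.ext
  intro ψ
  apply lp.ext
  funext n
  change robinJacobi a ψ n = robinJacobi 0 ψ n + (Pi.single 0 a : ℕ → ℂ) n * ψ n
  cases n with
  | zero =>
    rw [robinJacobi_apply_zero, robinJacobi_apply_zero, Pi.single_eq_same]
    ring
  | succ n =>
    rw [robinJacobi_apply_succ, robinJacobi_apply_succ, Pi.single_eq_of_ne n.succ_ne_zero,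
      zero_mul, add_zero]

/-! ### The spectrum -/

/-- The set on the right-hand side is the interval `[-2, 2]`. Both inclusions come from the
Fredholm alternative: neither `J_0` nor `J_a + V` has eigenvalues, and they differ by a compact
operator. -/
theorem spectrum_robinJacobi_add_potential {a : ℝ} (ha : |a| < 1) {v : ℕ → ℂ}
    (hv : BddAbove (Set.range fun n => ‖v n‖)) (h : DoubleSumCondition (|a| / (1 - |a|)) v) :
    spectrum ℂ (robinJacobi a + potential v hv) = {z | ∃ k : ℂ, ‖k‖ = 1 ∧ z = k + k⁻¹} := by
  have hα : 0 ≤ |a| / (1 - |a|) := div_nonneg (abs_nonneg a) (by linarith)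
  obtain ⟨K, hK, hT⟩ := exists_robinJacobi_add_potential_eq a hv (h.summable_norm hα)
  ext z
  rw [spectrum.mem_iff, Set.mem_ofPred_eq]
  constructor
  · intro hz
    obtain ⟨k, hk0, hk1, rfl⟩ := exists_eq_add_inv z
    refine ⟨k, hk1.eq_of_not_lt fun hk => hz ?_, rfl⟩
    rw [hT, ← sub_sub]
    refine isUnit_sub_of_isCompactOperator (isUnit_algebraMap_sub_robinJacobi_zero hk0 hk) hK
      fun ψ hψ => ?_
    rw [sub_sub, ← hT] at hψ
    exact eq_zero_of_robinJacobi_add_potential_eq ha hv h (sub_eq_zero.1 hψ).symm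
  · rintro ⟨k, hk, rfl⟩ hunit
    have hv0 : BddAbove (Set.range fun n => ‖(0 : ℕ → ℂ) n‖) := ⟨0, by rintro _ ⟨n, rfl⟩; simp⟩
    have hfree : algebraMap ℂ (EllTwo →L[ℂ] EllTwo) (k + k⁻¹) - robinJacobi 0 =
        algebraMap ℂ (EllTwo →L[ℂ] EllTwo) (k + k⁻¹) - (robinJacobi a + potential v hv) -
          -K := by
      rw [hT]
      abel
    refine not_isUnit_algebraMap_sub_robinJacobi_zero hk ?_
    rw [hfree]
    refine isUnit_sub_of_isCompactOperator hunit hK.neg fun ψ hψ => ?_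
    rw [← hfree] at hψ
    refine eq_zero_of_robinJacobi_add_potential_eq (a := 0) (by simp) hv0
      (doubleSumCondition_zero _) (z := k + k⁻¹) ?_
    rw [potential_zero, add_zero, Complex.ofReal_zero]
    exact (sub_eq_zero.1 hψ).symm

theorem DoubleSumCondition.spectrallyStable {a : ℝ} (ha : |a| < 1) {v : ℕ → ℂ}
    (h : DoubleSumCondition (|a| / (1 - |a|)) v) : SpectrallyStable a v := by
  have hα : 0 ≤ |a| / (1 - |a|) := div_nonneg (abs_nonneg a) (by linarith)
  have hv : BddAbove (Set.range fun n => ‖v n‖) :=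
    (h.summable_norm hα).tendsto_atTop_zero.bddAbove_range
  have hker (z : ℂ) (ψ : EllTwo) (hψ : (robinJacobi a + potential v hv) ψ = z • ψ) : ψ = 0 :=
    eq_zero_of_robinJacobi_add_potential_eq ha hv h hψ
  have hcont : spectrum ℂ (robinJacobi a + potential v hv) =
      continuousSpectrum (robinJacobi a + potential v hv) := by
    refine Set.Subset.antisymm (fun z hz => ⟨hz, fun ψ φ hψφ => ?_,
      denseRange_robinJacobi_add_potential_sub hv (hker z)⟩) fun z hz => hz.1
    refine sub_eq_zero.1 (hker z (ψ - φ) ?_)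
    rw [map_sub, smul_sub]
    exact sub_eq_sub_iff_sub_eq_sub.1 hψφ
  refine ⟨hv, hcont, ?_⟩
  have hv0 : BddAbove (Set.range fun n => ‖(0 : ℕ → ℂ) n‖) := ⟨0, by rintro _ ⟨n, rfl⟩; simp⟩
  have h0 : robinJacobi (a : ℂ) = robinJacobi a + potential 0 hv0 := by
    rw [potential_zero, add_zero]
  rw [← hcont, spectrum_robinJacobi_add_potential ha hv h, h0,
    spectrum_robinJacobi_add_potential ha hv0 (doubleSumCondition_zero _)]

theorem corollary5p3 (a : ℝ) (ha : -1 < a) (ha' : a < 1) (v : ℕ → ℂ) :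
    (DoubleSumCondition (|a| / (1 - |a|)) v → SpectrallyStable (a : ℂ) v) ∧
      (WeightedCondition (|a| / (1 - |a|)) v → DoubleSumCondition (|a| / (1 - |a|)) v) ∧
      (WeightedCondition (|a| / (1 - |a|)) v → SpectrallyStable (a : ℂ) v) := by
  have ha1 : |a| < 1 := abs_lt.2 ⟨ha, ha'⟩
  have hα : 0 ≤ |a| / (1 - |a|) := div_nonneg (abs_nonneg a) (by linarith)
  exact ⟨fun h => h.spectrallyStable ha1, fun h => h.doubleSumCondition hα,
    fun h => (h.doubleSumCondition hα).spectrallyStable ha1⟩
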